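/- \textbf{Theorem (weak compactness of multi-transport hyperrectangles).} Let $(\Xi_1,\rho_1),\dots,(\Xi_n,\rho_n)$ be proper metric spaces (that is, all closed bounded subsets are compact), let $\Xi=\Xi_1\times\cdots\times\Xi_n$, and let $\rho$ be a metric on $\Xi$ that is equivalent to an $\ell^q$ product metric: for some $q\in[1,\infty]$ there are constants $c,C>0$ such that $$c\,\rho^{(q)}(\zeta,\xi)\le\rho(\zeta,\xi)\le C\,\rho^{(q)}(\zeta,\xi)\qquad\text{for all }\zeta,\xi\in\Xi,$$ where $\rho^{(q)}(\zeta,\xi)=\big(\sum_{k=1}^n\rho_k(\zeta_k,\xi_k)^q\big)^{1/q}$ for $q<\infty$ and $\rho^{(\infty)}(\zeta,\xi)=\max_k\rho_k(\zeta_k,\xi_k)$. Let $\mathcal P(\Xi)$ be the set of Borel probability measures on $(\Xi,\rho)$, let $p\ge 1$, and let $Q\in\mathcal P(\Xi)$ have finite $p$-th moment, i.e. $\int_\Xi\rho(\zeta_0,\xi)^p\,dQ(\xi)<\infty$ for some $\zeta_0\in\Xi$. Then for every $\varepsilon=(\varepsilon_1,\dots,\varepsilon_n)$ with all $\varepsilon_k\ge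 0$, the multi-transport hyperrectangle $$\mathcal T_p(Q,\varepsilon)=\Big\{\mathrm{pr}_{2\#}\pi:\ \pi\in\mathcal P(\Xi\times\Xi),\ \mathrm{pr}_{1\#}\pi=Q,\ \int_{\Xi\times\Xi}\rho_k(\zeta_k,\xi_k)^p\,d\pi(\zeta,\xi)\le\varepsilon_k^p\ \text{ for all }k=1,\dots,n\Big\}$$ is a compact subset of $\mathcal P(\Xi)$ in the weak topology (the coarsest topology making $P\mapsto\int h\,dP$ continuous for every bounded continuous $h:\Xi\to\mathbb R$). -/

import Mathlib

open MeasureTheory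
open scoped ENNReal

noncomputable section

/-- The Cartesian product `Ξ₁ × ⋯ × Ξₙ`, as a bare set. It is a type synonym on which no metric,
topology or `σ`-algebra is preselected: these all come from the metric `ρ` that is put on it. -/
def ProductSpace {n : ℕ} (Ξ : Fin n → Type*) : Type _ := ∀ k, Ξ k

/-- The `ℓ^q` product metric `(∑ₖ ρₖ(ζₖ, ξₖ)^q)^(1/q)` (and `maxₖ ρₖ(ζₖ, ξₖ)` for `q = ∞`),
that is, the distance of Mathlib's `ℓ^q` product `PiLp q Ξ`. -/
def productDist {n : ℕ} {Ξ : Fin n → Type*} [∀ k, MetricSpace (Ξ k)] (q : ℝ≥0∞)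
    (ζ ξ : ProductSpace Ξ) : ℝ :=
  dist (WithLp.toLp q ζ : PiLp q Ξ) (WithLp.toLp q ξ : PiLp q Ξ)

theorem productDist_of_ne_top {n : ℕ} {Ξ : Fin n → Type*} [∀ k, MetricSpace (Ξ k)] {q : ℝ≥0∞}
    (hq : 1 ≤ q) (hq' : q ≠ ∞) (ζ ξ : ProductSpace Ξ) :
    productDist q ζ ξ = (∑ k, dist (ζ k) (ξ k) ^ q.toReal) ^ (1 / q.toReal) :=
  PiLp.dist_eq_sum (ENNReal.toReal_pos (zero_lt_one.trans_le hq).ne' hq') _ _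

theorem productDist_top {n : ℕ} {Ξ : Fin n → Type*} [∀ k, MetricSpace (Ξ k)]
    (ζ ξ : ProductSpace Ξ) : productDist ∞ ζ ξ = ⨆ k, dist (ζ k) (ξ k) :=
  PiLp.dist_eq_iSup _ _

/-- The metric `ρ` carried by the product is equivalent to the `ℓ^q` product metric for some
`q ∈ [1, ∞]`: each of the two is bounded by a constant multiple of the other. -/
def EquivalentToProductMetric {n : ℕ} (Ξ : Fin n → Type*) [∀ k, MetricSpace (Ξ k)]
    [MetricSpace (ProductSpace Ξ)] : Prop :=
  ∃ q : ℝ≥0∞, 1 ≤ q ∧ ∃ c C : ℝ, 0 < c ∧ 0 < C ∧ ∀ ζ ξ : ProductSpace Ξ,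
    c * productDist q ζ ξ ≤ dist ζ ξ ∧ dist ζ ξ ≤ C * productDist q ζ ξ

/-- `Q` has finite `p`-th moment: `∫ ρ(ζ₀, ξ)^p dQ(ξ) < ∞` for some point `ζ₀`. -/
def HasFiniteMoment {X : Type*} [MetricSpace X] [MeasurableSpace X] (p : ℝ)
    (Q : ProbabilityMeasure X) : Prop :=
  ∃ ζ₀ : X, ∫⁻ ξ, ENNReal.ofReal (dist ζ₀ ξ ^ p) ∂(Q : Measure X) < ∞

/-- The probability distributions `π` on `Ξ × Ξ` with first marginal `Q` and
`∫ ρₖ(ζₖ, ξₖ)^p dπ(ζ, ξ) ≤ εₖ^p` for every `k`. -/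
def transportPlans {n : ℕ} {Ξ : Fin n → Type*} [∀ k, MetricSpace (Ξ k)]
    [MeasurableSpace (ProductSpace Ξ)] (p : ℝ) (Q : ProbabilityMeasure (ProductSpace Ξ))
    (ε : Fin n → ℝ) : Set (ProbabilityMeasure (ProductSpace Ξ × ProductSpace Ξ)) :=
  {π | π.map measurable_fst.aemeasurable = Q ∧
    ∀ k, ∫⁻ z, ENNReal.ofReal (dist (z.1 k) (z.2 k) ^ p)
      ∂(π : Measure (ProductSpace Ξ × ProductSpace Ξ)) ≤ ENNReal.ofReal (ε k ^ p)}

/-- The multi-transport hyperrectangle `T_p(Q, ε)`: the second marginals of these plans. -/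
def multiTransportHyperrectangle {n : ℕ} {Ξ : Fin n → Type*} [∀ k, MetricSpace (Ξ k)]
    [MeasurableSpace (ProductSpace Ξ)] (p : ℝ) (Q : ProbabilityMeasure (ProductSpace Ξ))
    (ε : Fin n → ℝ) : Set (ProbabilityMeasure (ProductSpace Ξ)) :=
  (fun π => π.map measurable_snd.aemeasurable) '' transportPlans p Q ε

end

open Filter Topology Set
open scoped NNReal BoundedContinuousFunction

section Topology

variable {n : ℕ} {Ξ : Fin n → Type*} [∀ k, MetricSpace (Ξ k)]

/-! The hyperrectangle is the image of the set of admissible plans under the second marginal map,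
which is weakly continuous, so compactness of the plans suffices. By Prokhorov's theorem this
reduces to two facts. The plans are closed (`isClosed_transportPlans`), because transport costs are
weakly lower semicontinuous. They are tight (`isTightMeasureSet_transportPlans`): most of the mass
starts in a compact set, by tightness of `Q`, and Markov's inequality bounds the mass that moves far
in some coordinate; properness keeps the rest in a compact set. -/

theorem dist_apply_le_productDist {q : ℝ≥0∞} (hq : 1 ≤ q) (ζ ξ : ProductSpace Ξ) (k : Fin n) :
    dist (ζ k) (ξ k) ≤ productDist q ζ ξ := by
  have : Fact (1 ≤ q) := ⟨hq⟩
  simpa [productDist] using (PiLp.lipschitzWith_ofLp q Ξ).dist_le_mul (WithLp.toLp q ζ) (WithLp.toLp q ξ)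
    |>.trans' (dist_le_pi_dist (WithLp.ofLp (WithLp.toLp q ζ)) (WithLp.ofLp (WithLp.toLp q ξ)) k)

variable [MetricSpace (ProductSpace Ξ)]

/-- A metric equivalent to an `ℓ^q` product metric induces the product topology. -/
def EquivalentToProductMetric.homeomorph (hρ : EquivalentToProductMetric Ξ) :
    (∀ k, Ξ k) ≃ₜ ProductSpace Ξ where
  toFun x := x
  invFun x := x
  left_inv _ := rfl
  right_inv _ := rfl
  continuous_toFun := by
    obtain ⟨q, hq, c, C, -, hC, h⟩ := hρ
    have : Fact (1 ≤ q) := ⟨hq⟩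
    have hlip : LipschitzWith C.toNNReal
        (fun x : PiLp q Ξ ↦ (WithLp.ofLp x : ProductSpace Ξ)) :=
      LipschitzWith.of_dist_le_mul fun x y ↦ by
        simpa [hC.le, productDist] using (h (WithLp.ofLp x) (WithLp.ofLp y)).2
    exact hlip.continuous.comp (PiLp.continuous_toLp q Ξ)
  continuous_invFun := by
    obtain ⟨q, hq, c, C, hc, -, h⟩ := hρ
    refine continuous_pi fun k ↦ (LipschitzWith.of_dist_le_mul (K := c⁻¹.toNNReal) fun x y ↦ ?_ :
      LipschitzWith c⁻¹.toNNReal (fun x : ProductSpace Ξ ↦ x k)).continuous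
    rw [Real.coe_toNNReal _ (inv_nonneg.2 hc.le), inv_mul_eq_div, le_div_iff₀' hc]
    exact (mul_le_mul_of_nonneg_left (dist_apply_le_productDist hq x y k) hc.le).trans (h x y).1

theorem EquivalentToProductMetric.continuous_apply (hρ : EquivalentToProductMetric Ξ) (k : Fin n) :
    Continuous fun x : ProductSpace Ξ ↦ x k :=
  (_root_.continuous_apply k).comp hρ.homeomorph.symm.continuous

theorem EquivalentToProductMetric.continuous_dist_apply (hρ : EquivalentToProductMetric Ξ)
    (k : Fin n) :
    Continuous fun z : ProductSpace Ξ × ProductSpace Ξ ↦ dist (z.1 k) (z.2 k) :=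
  ((hρ.continuous_apply k).comp continuous_fst).dist ((hρ.continuous_apply k).comp continuous_snd)

/-- Proper metric spaces are complete and separable. Polishness makes the single measure `Q` tight
and the product `σ`-algebra on pairs Borel. -/
theorem EquivalentToProductMetric.polishSpace [∀ k, ProperSpace (Ξ k)]
    (hρ : EquivalentToProductMetric Ξ) : PolishSpace (ProductSpace Ξ) :=
  hρ.homeomorph.symm.isClosedEmbedding.polishSpace

end Topology

/-- The integral of a nonnegative continuous function is weakly lower semicontinuous in the
probability measure. -/
theorem isClosed_lintegral_le {X : Type*} [TopologicalSpace X] [MeasurableSpace X]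
    [OpensMeasurableSpace X] {f : X → ℝ≥0} (hf : Continuous f) (a : ℝ≥0∞) :
    IsClosed {μ : ProbabilityMeasure X | ∫⁻ x, f x ∂(μ : Measure X) ≤ a} := by
  -- Truncating at height `N` gives bounded continuous functions increasing to `f`; by monotone
  -- convergence the sublevel set is an intersection of closed ones.
  let g (N : ℕ) : X →ᵇ ℝ≥0 :=
    BoundedContinuousFunction.mkOfBound ⟨fun x ↦ min (f x) N, hf.min continuous_const⟩ N
      fun x y ↦ by
        rw [NNReal.dist_eq]
        exact abs_sub_le_of_nonneg_of_le (by simp) (by simp) (by simp) (by simp)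
  have hsup (μ : ProbabilityMeasure X) : ∫⁻ x, f x ∂(μ : Measure X)
      = ⨆ N, ∫⁻ x, g N x ∂(μ : Measure X) := by
    rw [← lintegral_iSup]
    · refine lintegral_congr fun x ↦ le_antisymm ?_ (iSup_le fun N ↦ ?_)
      · obtain ⟨N, hN⟩ := exists_nat_ge (f x)
        refine le_iSup_of_le N ?_
        simp [g, hN]
      · simp [g]
    · exact fun N ↦ (g N).continuous.measurable.coe_nnreal_ennreal
    · intro N M h x
      simp only [g, BoundedContinuousFunction.mkOfBound_coe, ContinuousMap.coe_mk]
      gcongr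
  simp only [hsup, iSup_le_iff, ofPred_forall]
  exact isClosed_iInter fun N ↦ isClosed_le
    (ProbabilityMeasure.continuous_lintegral_boundedContinuousFunction (g N)) continuous_const

section Plans

variable {n : ℕ} {Ξ : Fin n → Type*} [∀ k, MetricSpace (Ξ k)]
  [MetricSpace (ProductSpace Ξ)] [MeasurableSpace (ProductSpace Ξ)] [BorelSpace (ProductSpace Ξ)]
  [PolishSpace (ProductSpace Ξ)]

theorem isClosed_transportPlans (hρ : EquivalentToProductMetric Ξ) {p : ℝ} (hp : 0 ≤ p)
    (Q : ProbabilityMeasure (ProductSpace Ξ)) (ε : Fin n → ℝ) :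
    IsClosed (transportPlans p Q ε) := by
  refine IsClosed.inter (isClosed_eq (ProbabilityMeasure.continuous_map continuous_fst)
    continuous_const) ?_
  change IsClosed {π : ProbabilityMeasure (ProductSpace Ξ × ProductSpace Ξ) | _}
  rw [ofPred_forall]
  refine isClosed_iInter fun k ↦ isClosed_lintegral_le
    (f := fun z : ProductSpace Ξ × ProductSpace Ξ ↦ (dist (z.1 k) (z.2 k) ^ p).toNNReal) ?_ _
  exact continuous_real_toNNReal.comp ((hρ.continuous_dist_apply k).rpow_const fun _ ↦ Or.inr hp)

/-- Markov's inequality; the bound is the same for all admissible plans. -/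
theorem measure_lt_dist_le_of_mem_transportPlans {p : ℝ} (hp : 0 ≤ p)
    (hρ : EquivalentToProductMetric Ξ)
    {Q : ProbabilityMeasure (ProductSpace Ξ)} {ε : Fin n → ℝ}
    {π : ProbabilityMeasure (ProductSpace Ξ × ProductSpace Ξ)} (hπ : π ∈ transportPlans p Q ε)
    {R : ℝ} (hR : 0 < R) (k : Fin n) :
    (π : Measure (ProductSpace Ξ × ProductSpace Ξ)) {z | R < dist (z.1 k) (z.2 k)}
      ≤ ENNReal.ofReal (ε k ^ p) / ENNReal.ofReal (R ^ p) := by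
  have hd := (hρ.continuous_dist_apply k).measurable
  calc (π : Measure (ProductSpace Ξ × ProductSpace Ξ)) {z | R < dist (z.1 k) (z.2 k)}
      ≤ (π : Measure (ProductSpace Ξ × ProductSpace Ξ))
        {z | ENNReal.ofReal (R ^ p) ≤ ENNReal.ofReal (dist (z.1 k) (z.2 k) ^ p)} :=
        measure_mono fun z hz ↦
          ENNReal.ofReal_le_ofReal (Real.rpow_le_rpow hR.le (le_of_lt hz) hp)
    _ ≤ (∫⁻ z, ENNReal.ofReal (dist (z.1 k) (z.2 k) ^ p)
          ∂(π : Measure (ProductSpace Ξ × ProductSpace Ξ))) / ENNReal.ofReal (R ^ p) :=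
        meas_ge_le_lintegral_div (hd.pow_const p).ennreal_ofReal.aemeasurable
          (by simp [Real.rpow_pos_of_pos hR])
          ENNReal.ofReal_ne_top
    _ ≤ _ := ENNReal.div_le_div_right (hπ.2 k) _

variable [∀ k, ProperSpace (Ξ k)]

theorem isTightMeasureSet_transportPlans (hρ : EquivalentToProductMetric Ξ) {p : ℝ} (hp : 0 < p)
    (Q : ProbabilityMeasure (ProductSpace Ξ)) (ε : Fin n → ℝ) :
    IsTightMeasureSet {((π : ProbabilityMeasure (ProductSpace Ξ × ProductSpace Ξ)) :
      Measure (ProductSpace Ξ × ProductSpace Ξ)) | π ∈ transportPlans p Q ε} := by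
  rw [isTightMeasureSet_iff_exists_isCompact_measure_compl_le]
  intro η hη
  obtain ⟨K, hK, hQK⟩ := isTightMeasureSet_iff_exists_isCompact_measure_compl_le.1
    (isTightMeasureSet_singleton (μ := (Q : Measure (ProductSpace Ξ)))) (η / 2)
    (ENNReal.half_pos hη.ne')
  -- The radius `R` depends only on `ε`, `p` and `η`, so one compact set serves every plan.
  have hlim : Tendsto (fun R : ℝ ↦ (∑ k, ENNReal.ofReal (ε k ^ p)) / ENNReal.ofReal (R ^ p))
      atTop (𝓝 0) := by
    simpa using ENNReal.Tendsto.const_div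
      (ENNReal.tendsto_ofReal_atTop.comp (tendsto_rpow_atTop hp))
      (.inr (ENNReal.sum_ne_top.2 fun k _ ↦ ENNReal.ofReal_ne_top))
  obtain ⟨R, hRη, hR⟩ := ((hlim.eventually_le_const (ENNReal.half_pos hη.ne')).and
    (eventually_gt_atTop 0)).exists
  -- `L` contains every point within `R`, coordinate by coordinate, of a point of `K`. Closed
  -- thickenings of compact sets are compact in the proper factors.
  let L : Set (ProductSpace Ξ) := hρ.homeomorph ''
    univ.pi fun k ↦ Metric.cthickening R ((fun x : ProductSpace Ξ ↦ x k) '' K)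
  have hL : IsCompact L := (isCompact_univ_pi fun k ↦
    (hK.image (hρ.continuous_apply k)).cthickening).image hρ.homeomorph.continuous
  refine ⟨K ×ˢ L, hK.prod hL, ?_⟩
  rintro _ ⟨π, hπ, rfl⟩
  have hsub : (K ×ˢ L)ᶜ ⊆ Prod.fst ⁻¹' Kᶜ ∪
      ⋃ k, {z : ProductSpace Ξ × ProductSpace Ξ | R < dist (z.1 k) (z.2 k)} := by
    intro z hz
    by_contra! h
    simp only [mem_union, mem_preimage, mem_compl_iff, not_or, not_not, mem_iUnion, mem_ofPred_eq,
      not_exists, not_lt] at h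
    refine hz ⟨h.1, z.2, fun k _ ↦ ?_, rfl⟩
    exact Metric.mem_cthickening_of_dist_le _ (z.1 k) _ _ (mem_image_of_mem _ h.1)
      (by rw [dist_comm]; exact h.2 k)
  have hfst : (π : Measure (ProductSpace Ξ × ProductSpace Ξ)) (Prod.fst ⁻¹' Kᶜ) ≤ η / 2 := by
    rw [← Measure.map_apply measurable_fst hK.measurableSet.compl]
    have : (π : Measure (ProductSpace Ξ × ProductSpace Ξ)).map Prod.fst = Q :=
      congrArg ProbabilityMeasure.toMeasure hπ.1
    rw [this]
    exact hQK _ rfl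
  calc (π : Measure (ProductSpace Ξ × ProductSpace Ξ)) (K ×ˢ L)ᶜ
      ≤ _ + _ := (measure_mono hsub).trans (measure_union_le _ _)
    _ ≤ η / 2 + η / 2 := add_le_add hfst <| (measure_iUnion_fintype_le _ _).trans <|
        (Finset.sum_le_sum fun k _ ↦
          measure_lt_dist_le_of_mem_transportPlans hp.le hρ hπ hR k).trans <| by
        simpa only [div_eq_mul_inv, Finset.sum_mul] using hRη
    _ = η := ENNReal.add_halves η

theorem isCompact_transportPlans (hρ : EquivalentToProductMetric Ξ) {p : ℝ} (hp : 0 < p)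
    (Q : ProbabilityMeasure (ProductSpace Ξ)) (ε : Fin n → ℝ) :
    IsCompact (transportPlans p Q ε) := by
  rw [← (isClosed_transportPlans hρ hp.le Q ε).closure_eq]
  -- Prokhorov's theorem.
  exact isCompact_closure_of_isTightMeasureSet (isTightMeasureSet_transportPlans hρ hp Q ε)

end Plans

theorem mainTheorem1 {n : ℕ} {Ξ : Fin n → Type*}
    [∀ k, MetricSpace (Ξ k)] [∀ k, ProperSpace (Ξ k)]
    [MetricSpace (ProductSpace Ξ)] [MeasurableSpace (ProductSpace Ξ)]
    [BorelSpace (ProductSpace Ξ)]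
    (hρ : EquivalentToProductMetric Ξ)
    (p : ℝ) (hp : 1 ≤ p)
    (Q : ProbabilityMeasure (ProductSpace Ξ)) (hQ : HasFiniteMoment p Q)
    (ε : Fin n → ℝ) (hε : ∀ k, 0 ≤ ε k) :
    IsCompact (multiTransportHyperrectangle p Q ε) := by
  have := hρ.polishSpace
  exact (isCompact_transportPlans hρ (zero_lt_one.trans_le hp) Q ε).image
    (ProbabilityMeasure.continuous_map continuous_snd)
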